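/- Let $\mathbb{R}^3$ carry the standard contact structure $\ker(dz-y\,dx)$, and let $n\ge m\ge 3$. Consider a Legendrian embedding of the complete bipartite graph $K_{n,m}$ with parts $P$ ($|P|=n$) and $Q$ ($|Q|=m$): distinct vertices go to distinct points, and edges to smooth regular arcs tangent to the contact planes that meet each other only at common endpoints. Assume that its front projection $(x,y,z)\mapsto(x,z)$ is generic (finitely many cusps and crossings; semicubical cusps, none at an end of an edge; vertices are not multiple points; crossings are transverse double points away from cusps). For a cycle $\gamma$ of the graph let $tb(\gamma)=w(\gamma)-\frac12 c(\gamma)$, where in the front $w(\gamma)$ is the signed number of crossings of $\gamma$ (as an oriented closed curve, for either orientation) and $c(\gamma)$ is the number of its cusps, including those at vertices where the $x$-direction of $\gamma$ is reversed. Let $TB_k$ be the sum of $tb$ over all cycles of length $k$, and $TB$ the sum over all cycles. In the front, let $w_e$ be the sum over all edges of the writhe of the edge with itself; $w_{ae[P]}$ (resp. $w_{ae[Q]}$) the signed number of crossings between two edges, summed over all pairs of edges sharing a vertex of $P$ (resp. $Q$), one edge of the pair oriented towards and the other away from the common vertex; $w_{ne}$ the signed number of crossings between two edges, summed over all pairs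 of edges without common vertex, both oriented from $P$ to $Q$ (equivalently, coherently in the unique 4-cycle containing both); $c_e$ the number of cusps in the interiors of edges; $c_{v[P]}$ (resp. $c_{v[Q]}$) the number of pairs of edges at a vertex of $P$ (resp. $Q$), over all such vertices, that form a cusp there. Put $$F=(n-1)(m-1)w_e+(n-1)w_{ae[P]}+(m-1)w_{ae[Q]}+w_{ne}-\tfrac12\big[(n-1)(m-1)c_e+(n-1)c_{v[P]}+(m-1)c_{v[Q]}\big].$$ Then: 1. For every $2\le r\le m$, the number $\frac{(m-2)!\,(n-2)!}{(m-r)!\,(n-r)!}$ is a natural number and $$TB_{2r}=\frac{(m-2)!\,(n-2)!}{(m-r)!\,(n-r)!}\,TB_4=\frac{(m-2)!\,(n-2)!}{(m-r)!\,(n-r)!}\,F,$$ while $TB_k=0$ for odd $k$. 2. $\displaystyle TB=TB_4\cdot\sum_{r=2}^m\frac{(m-2)!\,(n-2)!}{(m-r)!\,(n-r)!}$. 3. $TB_4=F$. -/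

import Mathlib

open scoped ContDiff

/-- A Legendrian embedding of a graph `G` in `ℝ³`, coordinates `(x, y, z) = (p 0, p 1, p 2)`, with
the standard contact structure `ker (dz - y dx)`. Every edge, given one of its two orientations (a
dart `d`), is a smooth regular arc `arc d`, parametrized by `[0, 1]`, from the first to the second
endpoint; the other orientation is the same arc run backwards. -/
structure LegendrianEmbedding {V : Type*} (G : SimpleGraph V) where
  pos : V → EuclideanSpace ℝ (Fin 3)
  arc : G.Dart → ℝ → EuclideanSpace ℝ (Fin 3)
  arc_zero : ∀ d, arc d 0 = pos d.fst
  arc_one : ∀ d, arc d 1 = pos d.snd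
  arc_symm : ∀ d, ∀ t ∈ Set.Icc (0 : ℝ) 1, arc d.symm t = arc d (1 - t)
  smooth : ∀ d, ContDiffOn ℝ ∞ (arc d) (Set.Icc 0 1)
  regular : ∀ d, ∀ t ∈ Set.Icc (0 : ℝ) 1, derivWithin (arc d) (Set.Icc 0 1) t ≠ 0
  /-- the arcs are tangent to the contact planes: `dz = y dx` -/
  legendrian : ∀ d, ∀ t ∈ Set.Icc (0 : ℝ) 1,
    derivWithin (arc d) (Set.Icc 0 1) t 2 = arc d t 1 * derivWithin (arc d) (Set.Icc 0 1) t 0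
  /-- distinct vertices are distinct points -/
  pos_injective : Function.Injective pos
  /-- no vertex lies in the interior of an edge -/
  arc_ne_pos : ∀ d, ∀ t ∈ Set.Ioo (0 : ℝ) 1, ∀ v, arc d t ≠ pos v
  /-- edges have no self-intersections, and different edges have disjoint interiors -/
  arc_injective : ∀ d e, ∀ s ∈ Set.Ioo (0 : ℝ) 1, ∀ t ∈ Set.Ioo (0 : ℝ) 1, arc d s = arc e t →
    (e = d ∧ t = s) ∨ (e = d.symm ∧ t = 1 - s)

namespace LegendrianEmbedding

variable {V : Type*} {G : SimpleGraph V}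

/-- The front projection `(x, y, z) ↦ (x, z)`. -/
def front (p : EuclideanSpace ℝ (Fin 3)) : ℝ × ℝ := (p 0, p 2)

/-- The tangent vector of an oriented edge. -/
noncomputable def vel (E : LegendrianEmbedding G) (d : G.Dart) (t : ℝ) :
    EuclideanSpace ℝ (Fin 3) :=
  derivWithin (E.arc d) (Set.Icc 0 1) t

/-- The fronts of the points `arc d s` and `arc e t` cross, the first strand passing over the
second. In the `(x, z)`-plane, `x` pointing right and `z` up, the positive `y`-axis points away from
the viewer, so that the strand with the smaller `y` is the upper one. -/
def IsCrossing (E : LegendrianEmbedding G) (d : G.Dart) (s : ℝ) (e : G.Dart) (t : ℝ) : Prop :=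
  s ∈ Set.Icc (0 : ℝ) 1 ∧ t ∈ Set.Icc (0 : ℝ) 1 ∧ front (E.arc d s) = front (E.arc e t) ∧
    E.arc d s 1 < E.arc e t 1

/-- The sign of a crossing: that of the determinant of the front tangent vectors
(over strand, under strand) in the `(x, z)`-plane. -/
noncomputable def crossingSign (E : LegendrianEmbedding G) (d : G.Dart) (s : ℝ) (e : G.Dart)
    (t : ℝ) : ℤ :=
  (SignType.sign (E.vel d s 0 * E.vel e t 2 - E.vel d s 2 * E.vel e t 0) : ℤ)

/-- A cusp in the interior of an edge. -/
def IsEdgeCusp (E : LegendrianEmbedding G) (d : G.Dart) (t : ℝ) : Prop :=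
  t ∈ Set.Ioo (0 : ℝ) 1 ∧ E.vel d t 0 = 0

/-- The path that arrives along `d` and leaves along `e` has a cusp at the vertex in between: the
`x`-direction of its front is reversed there. (All edges at a vertex have the same front slope at
the vertex, namely its `y`-coordinate.) -/
def IsVertexCusp (E : LegendrianEmbedding G) (d e : G.Dart) : Prop :=
  E.vel d 1 0 * E.vel e 0 0 < 0

/-- The front projection of the Legendrian graph is generic: finitely many crossings and cusps; the
cusps along edges are semicubical, none lies at an endpoint of an edge; no vertex is a multiple
point; every crossing is a double point of two strands neither of which has a cusp there.
(Crossings are then transverse, as the slopes `y` of the two strands differ.) -/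
structure IsGenericFront (E : LegendrianEmbedding G) : Prop where
  finite_crossings : ∀ d e, {p : ℝ × ℝ | E.IsCrossing d p.1 e p.2}.Finite
  finite_cusps : ∀ d, {t : ℝ | E.IsEdgeCusp d t}.Finite
  vel_vertex : ∀ d, E.vel d 0 0 ≠ 0
  cusp_semicubical : ∀ d t, E.IsEdgeCusp d t →
    derivWithin (fun u => E.vel d u 0) (Set.Icc 0 1) t ≠ 0
  front_vertex_injective : ∀ v w, front (E.pos v) = front (E.pos w) → v = w
  front_vertex_edge : ∀ v d, ∀ t ∈ Set.Icc (0 : ℝ) 1, front (E.arc d t) = front (E.pos v) →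
    E.arc d t = E.pos v
  crossing_not_cusp : ∀ d s e t, E.IsCrossing d s e t → E.vel d s 0 ≠ 0 ∧ E.vel e t 0 ≠ 0
  no_triple : ∀ d s e t f, ∀ u ∈ Set.Icc (0 : ℝ) 1, E.IsCrossing d s e t →
    front (E.arc f u) = front (E.arc d s) → E.arc f u = E.arc d s ∨ E.arc f u = E.arc e t

/-- The signed sum of the crossings at which `d` passes over `e`. -/
noncomputable def overWrithe (E : LegendrianEmbedding G) (d e : G.Dart) : ℤ :=
  ∑ᶠ (p : ℝ × ℝ) (_ : E.IsCrossing d p.1 e p.2), E.crossingSign d p.1 e p.2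

/-- `w(e)`, the writhe of an edge with itself (the same for both of its orientations). -/
noncomputable def edgeWrithe (E : LegendrianEmbedding G) (d : G.Dart) : ℤ :=
  E.overWrithe d d

/-- `w(e, f)`, the signed sum of the crossings between two different oriented edges. -/
noncomputable def pairWrithe (E : LegendrianEmbedding G) (d e : G.Dart) : ℤ :=
  E.overWrithe d e + E.overWrithe e d

/-- `c(e)`, the number of cusps along an edge. -/
noncomputable def edgeCusps (E : LegendrianEmbedding G) (d : G.Dart) : ℕ :=
  {t : ℝ | E.IsEdgeCusp d t}.ncard

open Classical in
/-- The number (`0` or `1`) of cusps at the vertex of the path along `d` and then along `e`. -/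
noncomputable def vertexCusp (E : LegendrianEmbedding G) (d e : G.Dart) : ℕ :=
  if E.IsVertexCusp d e then 1 else 0

end LegendrianEmbedding

/-- A `k`-cycle of `G` with a starting vertex and a direction: `k ≥ 3` distinct vertices in cyclic
order, consecutive ones adjacent. -/
structure ParamCycle {V : Type*} (G : SimpleGraph V) (k : ℕ) where
  vert : ZMod k → V
  three_le : 3 ≤ k
  injective : Function.Injective vert
  adj : ∀ i, G.Adj (vert i) (vert (i + 1))

namespace ParamCycle

variable {V : Type*} {G : SimpleGraph V} {k : ℕ}

/-- The `i`-th oriented edge of the cycle. -/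
def dart (c : ParamCycle G k) (i : ZMod k) : G.Dart := ⟨(c.vert i, c.vert (i + 1)), c.adj i⟩

/-- Two parametrized cycles are the same cycle if they differ by a rotation or a reflection. -/
def setoid (G : SimpleGraph V) (k : ℕ) : Setoid (ParamCycle G k) where
  r c c' := ∃ a : ZMod k, (∀ i, c'.vert i = c.vert (i + a)) ∨ (∀ i, c'.vert i = c.vert (a - i))
  iseqv := by
    refine ⟨fun c => ⟨0, Or.inl fun i => by simp⟩, ?_, ?_⟩
    · rintro c c' ⟨a, h | h⟩
      · exact ⟨-a, Or.inl fun i => by rw [h]; congr 1; ring⟩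
      · exact ⟨a, Or.inr fun i => by rw [h]; congr 1; ring⟩
    · rintro c c' c'' ⟨a, h | h⟩ ⟨b, h' | h'⟩
      · exact ⟨b + a, Or.inl fun i => by rw [h', h]; congr 1; ring⟩
      · exact ⟨b + a, Or.inr fun i => by rw [h', h]; congr 1; ring⟩
      · exact ⟨a - b, Or.inr fun i => by rw [h', h]; congr 1; ring⟩
      · exact ⟨a - b, Or.inl fun i => by rw [h', h]; congr 1; ring⟩

end ParamCycle

/-- The `k`-cycles of the graph `G` (`k ≥ 3`), neither based nor oriented. -/
def GraphCycle {V : Type*} (G : SimpleGraph V) (k : ℕ) : Type _ := Quotient (ParamCycle.setoid G k)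

namespace LegendrianEmbedding

variable {V : Type*} {G : SimpleGraph V} {k : ℕ}

/-- The writhe of a cycle: the signed sum of the crossings of the closed curve that it forms, a
point of which is given by the number of the edge and the parameter along this edge. -/
noncomputable def writhe (E : LegendrianEmbedding G) (c : ParamCycle G k) : ℤ :=
  ∑ᶠ (p : (ZMod k × ℝ) × (ZMod k × ℝ))
    (_ : E.IsCrossing (c.dart p.1.1) p.1.2 (c.dart p.2.1) p.2.2),
    E.crossingSign (c.dart p.1.1) p.1.2 (c.dart p.2.1) p.2.2

/-- The number of cusps of a cycle: the ones along its edges and the ones at its vertices. -/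
noncomputable def cusps (E : LegendrianEmbedding G) (c : ParamCycle G k) : ℕ :=
  {p : ZMod k × ℝ | E.IsEdgeCusp (c.dart p.1) p.2}.ncard +
    {i : ZMod k | E.IsVertexCusp (c.dart i) (c.dart (i + 1))}.ncard

/-- The Thurston-Bennequin number `w - c / 2` of a parametrized cycle. -/
noncomputable def tbParam (E : LegendrianEmbedding G) (c : ParamCycle G k) : ℚ :=
  E.writhe c - (1 / 2) * E.cusps c

theorem vel_symm (E : LegendrianEmbedding G) (d : G.Dart) {t : ℝ} (ht : t ∈ Set.Icc (0 : ℝ) 1) :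
    E.vel d.symm t = - E.vel d (1 - t) := by
  have ht' : 1 - t ∈ Set.Icc (0 : ℝ) 1 := ⟨by linarith [ht.2], by linarith [ht.1]⟩
  have hd : HasDerivWithinAt (E.arc d) (E.vel d (1 - t)) (Set.Icc 0 1) (1 - t) :=
    (((E.smooth d).differentiableOn (by simp)) _ ht').hasDerivWithinAt
  have h1 : HasDerivWithinAt (fun u : ℝ => 1 - u) (-1) (Set.Icc 0 1) t := by
    simpa using (hasDerivAt_id t).const_sub 1 |>.hasDerivWithinAt
  have h2 := hd.scomp t h1 (fun u hu => ⟨by linarith [hu.2], by linarith [hu.1]⟩)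
  have h3 : HasDerivWithinAt (E.arc d.symm) ((-1 : ℝ) • E.vel d (1 - t)) (Set.Icc 0 1) t :=
    h2.congr (fun u hu => E.arc_symm d u hu) (E.arc_symm d t ht)
  have := h3.derivWithin (uniqueDiffOn_Icc zero_lt_one t ht)
  simpa [vel] using this

theorem isCrossing_symm (E : LegendrianEmbedding G) (d e : G.Dart) (s t : ℝ) :
    E.IsCrossing d.symm s e.symm t ↔ E.IsCrossing d (1 - s) e (1 - t) := by
  unfold IsCrossing
  constructor
  · rintro ⟨hs, ht, h⟩
    rw [E.arc_symm d s hs, E.arc_symm e t ht] at h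
    exact ⟨⟨by linarith [hs.2], by linarith [hs.1]⟩, ⟨by linarith [ht.2], by linarith [ht.1]⟩, h⟩
  · rintro ⟨hs, ht, h⟩
    have hs' : s ∈ Set.Icc (0 : ℝ) 1 := ⟨by linarith [hs.2], by linarith [hs.1]⟩
    have ht' : t ∈ Set.Icc (0 : ℝ) 1 := ⟨by linarith [ht.2], by linarith [ht.1]⟩
    rw [E.arc_symm d s hs', E.arc_symm e t ht']
    exact ⟨hs', ht', h⟩

theorem crossingSign_symm (E : LegendrianEmbedding G) (d e : G.Dart) {s t : ℝ}
    (hs : s ∈ Set.Icc (0 : ℝ) 1) (ht : t ∈ Set.Icc (0 : ℝ) 1) :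
    E.crossingSign d.symm s e.symm t = E.crossingSign d (1 - s) e (1 - t) := by
  simp [crossingSign, E.vel_symm d hs, E.vel_symm e ht]

theorem isEdgeCusp_symm (E : LegendrianEmbedding G) (d : G.Dart) (t : ℝ) :
    E.IsEdgeCusp d.symm t ↔ E.IsEdgeCusp d (1 - t) := by
  unfold IsEdgeCusp
  constructor
  · rintro ⟨h, h'⟩
    rw [E.vel_symm d ⟨h.1.le, h.2.le⟩] at h'
    exact ⟨⟨by linarith [h.2], by linarith [h.1]⟩, by simpa using h'⟩
  · rintro ⟨h, h'⟩
    have h0 : t ∈ Set.Ioo (0 : ℝ) 1 := ⟨by linarith [h.2], by linarith [h.1]⟩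
    rw [E.vel_symm d ⟨h0.1.le, h0.2.le⟩]
    exact ⟨h0, by simpa using h'⟩

theorem isVertexCusp_symm (E : LegendrianEmbedding G) (d e : G.Dart) :
    E.IsVertexCusp d.symm e.symm ↔ E.IsVertexCusp e d := by
  simp [IsVertexCusp, E.vel_symm d (t := 1) (by simp), E.vel_symm e (t := 0) (by simp), mul_comm]

theorem tbParam_rotate (E : LegendrianEmbedding G) (c c' : ParamCycle G k) (a : ZMod k)
    (h : ∀ i, c'.vert i = c.vert (i + a)) : E.tbParam c' = E.tbParam c := by
  have hd : ∀ i, c'.dart i = c.dart (i + a) := fun i => by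
    simp only [ParamCycle.dart, h, add_right_comm]
  have hw : E.writhe c' = E.writhe c := by
    let f : ZMod k × ℝ ≃ ZMod k × ℝ := (Equiv.addRight a).prodCongr (Equiv.refl ℝ)
    simp only [writhe, hd]
    exact finsum_comp_equiv (f.prodCongr f) (f := fun p : (ZMod k × ℝ) × (ZMod k × ℝ) =>
      ∑ᶠ (_ : E.IsCrossing (c.dart p.1.1) p.1.2 (c.dart p.2.1) p.2.2),
        E.crossingSign (c.dart p.1.1) p.1.2 (c.dart p.2.1) p.2.2)
  have hc : E.cusps c' = E.cusps c := by
    let f : ZMod k × ℝ ≃ ZMod k × ℝ := (Equiv.addRight a).prodCongr (Equiv.refl ℝ)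
    simp only [cusps, hd]
    congr 1
    · exact Set.ncard_congr (fun p _ => f p) (fun p hp => hp)
        (fun p q _ _ hpq => f.injective hpq) (fun q hq => ⟨f.symm q, by
          simpa [f] using hq, by simp⟩)
    · refine Set.ncard_congr (fun p _ => p + a) (fun p hp => ?_) (fun p q _ _ hpq =>
        add_right_cancel hpq) (fun q hq => ⟨q - a, ?_, by ring⟩)
      · simpa only [Set.mem_ofPred_eq, add_right_comm] using hp
      · have : q - a + 1 + a = q + 1 := by ring
        simpa [this] using hq
  rw [tbParam, tbParam, hw, hc]

theorem tbParam_reflect (E : LegendrianEmbedding G) (c c' : ParamCycle G k) (a : ZMod k)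
    (h : ∀ i, c'.vert i = c.vert (a - i)) : E.tbParam c' = E.tbParam c := by
  have hd : ∀ i, c'.dart i = (c.dart (a - 1 - i)).symm := fun i => by
    have h1 : a - 1 - i + 1 = a - i := by ring
    have h2 : a - (i + 1) = a - 1 - i := by ring
    apply SimpleGraph.Dart.ext
    simp only [ParamCycle.dart, h, SimpleGraph.Dart.symm, Prod.swap, h1, h2]
  let f : ZMod k × ℝ ≃ ZMod k × ℝ := (Equiv.subLeft (a - 1)).prodCongr (Equiv.subLeft 1)
  have hw : E.writhe c' = E.writhe c := by
    refine Eq.trans ?_ (finsum_comp_equiv (f.prodCongr f)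
      (f := fun p : (ZMod k × ℝ) × (ZMod k × ℝ) =>
        ∑ᶠ (_ : E.IsCrossing (c.dart p.1.1) p.1.2 (c.dart p.2.1) p.2.2),
          E.crossingSign (c.dart p.1.1) p.1.2 (c.dart p.2.1) p.2.2))
    refine finsum_congr fun p => ?_
    refine finsum_congr_Prop ?_ ?_
    · simp only [hd]
      exact propext (E.isCrossing_symm _ _ _ _)
    · intro hp
      have hp' := (E.isCrossing_symm _ _ _ _).2 hp
      simp only [hd]
      exact E.crossingSign_symm _ _ hp'.1 hp'.2.1
  have hc : E.cusps c' = E.cusps c := by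
    simp only [cusps, hd]
    congr 1
    · refine Set.ncard_congr (fun p _ => f p) (fun p hp => ?_)
        (fun p q _ _ hpq => f.injective hpq) (fun q hq => ⟨f.symm q, ?_, by simp⟩)
      · exact (E.isEdgeCusp_symm _ _).1 hp
      · refine (E.isEdgeCusp_symm _ _).2 ?_
        have : f (f.symm q) = q := by simp
        change E.IsEdgeCusp (c.dart (f (f.symm q)).1) (f (f.symm q)).2
        rwa [this]
    · refine Set.ncard_congr (fun p _ => a - 1 - (p + 1)) (fun p hp => ?_) (fun p q _ _ hpq => by
        simpa using hpq) (fun q hq => ⟨a - 1 - (q + 1), ?_, by ring⟩)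
      · have h1 : a - 1 - (p + 1) + 1 = a - 1 - p := by ring
        simp only [Set.mem_ofPred_eq, h1]
        exact (E.isVertexCusp_symm _ _).1 hp
      · refine (E.isVertexCusp_symm _ _).2 ?_
        have h1 : a - 1 - (a - 1 - (q + 1) + 1) = q := by ring
        have h2 : a - 1 - (a - 1 - (q + 1)) = q + 1 := by ring
        rw [h1, h2]
        exact hq
  rw [tbParam, tbParam, hw, hc]

/-- The Thurston-Bennequin number of a cycle; it depends neither on the starting vertex nor on the
orientation. -/
noncomputable def tb (E : LegendrianEmbedding G) (C : GraphCycle G k) : ℚ :=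
  Quotient.lift (s := ParamCycle.setoid G k) E.tbParam (by
    rintro c c' ⟨a, h | h⟩
    · exact (E.tbParam_rotate c c' a h).symm
    · exact (E.tbParam_reflect c c' a h).symm) C

/-- `TB_k`, the sum of the Thurston-Bennequin numbers over all `k`-cycles. -/
noncomputable def TBLen (E : LegendrianEmbedding G) (k : ℕ) : ℚ :=
  ∑ᶠ C : GraphCycle G k, E.tb C

/-- The total Thurston-Bennequin number: the sum over all cycles, of any length. -/
noncomputable def TB (E : LegendrianEmbedding G) : ℚ :=
  ∑ᶠ C : Σ k : ℕ, GraphCycle G k, E.tb C.2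

end LegendrianEmbedding

/-- The edge of `K_{n,m}` between the vertex `p` of the `n`-partition `P` and the vertex `q` of the
`m`-partition `Q`, oriented from `P` to `Q`. Its other orientation is `(dartPQ p q).symm`. -/
def dartPQ {n m : ℕ} (p : Fin n) (q : Fin m) : (completeBipartiteGraph (Fin n) (Fin m)).Dart :=
  ⟨(Sum.inl p, Sum.inr q), by simp⟩

namespace LegendrianEmbedding

variable {n m : ℕ} (E : LegendrianEmbedding (completeBipartiteGraph (Fin n) (Fin m)))

/-- `w_e`, the edge writhe. -/
noncomputable def wE : ℤ := ∑ p, ∑ q, E.edgeWrithe (dartPQ p q)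

/-- `w_{ae[P]}`: the sum over all pairs of edges adjacent at a vertex of `P`; the two edges are
oriented coherently, one towards and one away from the common vertex. -/
noncomputable def wAdjP : ℤ :=
  ∑ p, ∑ q, ∑ q' ∈ Finset.Ioi q, E.pairWrithe (dartPQ p q).symm (dartPQ p q')

/-- `w_{ae[Q]}`: the sum over all pairs of edges adjacent at a vertex of `Q`; the two edges are
oriented coherently, one towards and one away from the common vertex. -/
noncomputable def wAdjQ : ℤ :=
  ∑ q, ∑ p, ∑ p' ∈ Finset.Ioi p, E.pairWrithe (dartPQ p q) (dartPQ p' q).symm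

/-- `w_{ne}`: the sum over all pairs of non-adjacent edges, oriented coherently in the 4-cycle
that contains both of them, that is, both from `P` to `Q`. -/
noncomputable def wNonadj : ℤ :=
  ∑ p, ∑ p' ∈ Finset.Ioi p, ∑ q, ∑ q' ∈ Finset.univ.erase q,
    E.pairWrithe (dartPQ p q) (dartPQ p' q')

/-- `c_e`, the edge cusps. -/
noncomputable def cE : ℕ := ∑ p, ∑ q, E.edgeCusps (dartPQ p q)

/-- `c_{v[P]}`: the cusps at the vertices in `P`, over all pairs of edges at the vertex. -/
noncomputable def cVertP : ℕ :=
  ∑ p, ∑ q, ∑ q' ∈ Finset.Ioi q, E.vertexCusp (dartPQ p q).symm (dartPQ p q')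

/-- `c_{v[Q]}`: the cusps at the vertices in `Q`, over all pairs of edges at the vertex. -/
noncomputable def cVertQ : ℕ :=
  ∑ q, ∑ p, ∑ p' ∈ Finset.Ioi p, E.vertexCusp (dartPQ p q) (dartPQ p' q).symm

/-- The combination of writhes and cusp counts of a front of `K_{n,m}` that computes `TB_4`. -/
noncomputable def frontCount : ℚ :=
  ((n : ℚ) - 1) * ((m : ℚ) - 1) * E.wE + ((n : ℚ) - 1) * E.wAdjP + ((m : ℚ) - 1) * E.wAdjQ
    + E.wNonadj
    - (1 / 2) * (((n : ℚ) - 1) * ((m : ℚ) - 1) * E.cE + ((n : ℚ) - 1) * E.cVertP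
      + ((m : ℚ) - 1) * E.cVertQ)

end LegendrianEmbedding

/-- The factor `(m-2)! (n-2)! / ((m-r)! (n-r)!)`, for `2 ≤ r ≤ m ≤ n`. -/
def cycleFactor (n m r : ℕ) : ℚ :=
  ((m - 2).factorial * (n - 2).factorial : ℚ) / ((m - r).factorial * (n - r).factorial)

/-! The proof is a double count. The writhe of a cycle is a sum over ordered pairs (over edge, under
edge) of its oriented edges, and its cusp number is a sum over its edges and its corners
(`writhe_eq_sum`, `cusps_eq_sum`). A 2r-cycle of a bipartite graph, parametrized from a vertex of P,
is the same as a pair of embeddings of `ZMod r` into P and into Q, and every cycle arises from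
exactly 2r such pairs (`two_mul_TBLen`). With the positions along the cycle fixed, the sum over all
embeddings of a function of the vertices there depends only on which positions coincide, and is a
descending factorial multiple of a sum over the graph (`sum_embeddings_apply` and its variants).

The decisive point is a cancellation (`sum_embeddings_writhe`). Edges traversed from Q to P
contribute with the opposite sign, so for most pairs of positions the four sign combinations add up
to zero. What survives is 2r times one combination of the four types of pairs: equal edges, adjacent
at P, adjacent at Q, disjoint. Since (n-1)_{r-1} = (n-1)(n-2)_{r-2} for descending factorials, the
r-dependence is then the common factor (n-2)_{r-2}(m-2)_{r-2}, and the rest is `frontCount`. The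
case r = 2 identifies it with TB_4. -/

/-! ### Splitting finite sums and cardinalities over a finite index -/

theorem finsum_prod_finite_left {ι β M : Type*} [Fintype ι] [AddCommMonoid M] (f : ι → β → M)
    (hf : ∀ i, (Function.support (f i)).Finite) :
    ∑ᶠ p : ι × β, f p.1 p.2 = ∑ i, ∑ᶠ b, f i b := by
  rw [finsum_curry, finsum_eq_sum_of_fintype]
  refine (Set.finite_iUnion fun i => (hf i).image (Prod.mk i)).subset ?_
  rintro ⟨i, b⟩ hp
  exact Set.mem_iUnion.2 ⟨i, b, hp, rfl⟩

theorem ncard_prod_eq_sum {ι β : Type*} [Fintype ι] (S : ι → Set β) (hS : ∀ i, (S i).Finite) :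
    {p : ι × β | p.2 ∈ S p.1}.ncard = ∑ i, (S i).ncard := by
  have : ∀ i, Finite (S i) := fun i => (hS i).to_subtype
  simp only [← Nat.card_coe_set_eq]
  rw [← Nat.card_sigma]
  exact Nat.card_congr
    { toFun := fun p => ⟨p.1.1, p.1.2, p.2⟩
      invFun := fun p => ⟨(p.1, p.2.1), p.2.2⟩ }

/-! ### Reversing edges; writhe and cusps of a cycle edge by edge -/

namespace LegendrianEmbedding

variable {V : Type*} {G : SimpleGraph V} {k : ℕ}

theorem isCrossing_symm_right (E : LegendrianEmbedding G) (d e : G.Dart) (s t : ℝ) :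
    E.IsCrossing d s e.symm t ↔ E.IsCrossing d s e (1 - t) := by
  unfold IsCrossing
  constructor
  · rintro ⟨hs, ht, h⟩
    rw [E.arc_symm e t ht] at h
    exact ⟨hs, ⟨by linarith [ht.2], by linarith [ht.1]⟩, h⟩
  · rintro ⟨hs, ht, h⟩
    have ht' : t ∈ Set.Icc (0 : ℝ) 1 := ⟨by linarith [ht.2], by linarith [ht.1]⟩
    rw [E.arc_symm e t ht']
    exact ⟨hs, ht', h⟩

theorem crossingSign_symm_right (E : LegendrianEmbedding G) (d e : G.Dart) (s : ℝ) {t : ℝ}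
    (ht : t ∈ Set.Icc (0 : ℝ) 1) :
    E.crossingSign d s e.symm t = -E.crossingSign d s e (1 - t) := by
  have h : ∀ a b c d : ℝ, a * -b - c * -d = -(a * b - c * d) := fun a b c d => by ring
  simp only [crossingSign, E.vel_symm e ht, PiLp.neg_apply, h, Left.sign_neg, SignType.coe_neg]

/-- Reversal negates one tangent vector, hence the determinant at each crossing. This allows every
writhe to be expressed with all edges oriented from P to Q. -/
theorem overWrithe_symm_right (E : LegendrianEmbedding G) (d e : G.Dart) :
    E.overWrithe d e.symm = -E.overWrithe d e := by
  let f : ℝ × ℝ ≃ ℝ × ℝ := (Equiv.refl ℝ).prodCongr (Equiv.subLeft 1)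
  rw [overWrithe, overWrithe, ← finsum_neg_distrib]
  refine Eq.trans ?_ (finsum_comp_equiv f (f := fun p : ℝ × ℝ =>
    -∑ᶠ (_ : E.IsCrossing d p.1 e p.2), E.crossingSign d p.1 e p.2))
  refine finsum_congr fun p => ?_
  rw [← finsum_neg_distrib]
  refine finsum_congr_Prop (propext (E.isCrossing_symm_right _ _ _ _)) fun hp => ?_
  exact E.crossingSign_symm_right d e p.1 ((E.isCrossing_symm_right _ _ _ _).2 hp).2.1

theorem overWrithe_symm_symm (E : LegendrianEmbedding G) (d e : G.Dart) :
    E.overWrithe d.symm e.symm = E.overWrithe d e := by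
  let f : ℝ × ℝ ≃ ℝ × ℝ := (Equiv.subLeft 1).prodCongr (Equiv.subLeft 1)
  rw [overWrithe, overWrithe]
  refine Eq.trans ?_ (finsum_comp_equiv f (f := fun p : ℝ × ℝ =>
    ∑ᶠ (_ : E.IsCrossing d p.1 e p.2), E.crossingSign d p.1 e p.2))
  refine finsum_congr fun p => ?_
  refine finsum_congr_Prop (propext (E.isCrossing_symm _ _ _ _)) fun hp => ?_
  have hp' := (E.isCrossing_symm _ _ _ _).2 hp
  exact E.crossingSign_symm _ _ hp'.1 hp'.2.1

theorem overWrithe_symm_left (E : LegendrianEmbedding G) (d e : G.Dart) :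
    E.overWrithe d.symm e = -E.overWrithe d e := by
  rw [← E.overWrithe_symm_symm d e, E.overWrithe_symm_right, neg_neg]

theorem edgeCusps_symm (E : LegendrianEmbedding G) (d : G.Dart) :
    E.edgeCusps d.symm = E.edgeCusps d := by
  refine Set.ncard_congr (fun t _ => 1 - t) (fun t ht => (E.isEdgeCusp_symm d t).1 ht)
    (fun s t _ _ h => by simpa using h) fun t ht => ⟨1 - t, ?_, by ring⟩
  refine (E.isEdgeCusp_symm d (1 - t)).2 ?_
  simpa using ht

theorem vertexCusp_symm (E : LegendrianEmbedding G) (d e : G.Dart) :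
    E.vertexCusp e.symm d.symm = E.vertexCusp d e := by
  classical
  simp only [vertexCusp]
  exact if_congr (E.isVertexCusp_symm e d) rfl rfl

/-- Finiteness of the crossings is essential: a `finsum` with infinite support is 0, so it could not
be split by pairs of edges otherwise. -/
theorem writhe_eq_sum [NeZero k] (E : LegendrianEmbedding G) (hE : E.IsGenericFront)
    (c : ParamCycle G k) : E.writhe c = ∑ i, ∑ j, E.overWrithe (c.dart i) (c.dart j) := by
  have h := finsum_prod_finite_left
    (fun (i : ZMod k × ZMod k) (p : ℝ × ℝ) =>
      ∑ᶠ _ : E.IsCrossing (c.dart i.1) p.1 (c.dart i.2) p.2,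
        E.crossingSign (c.dart i.1) p.1 (c.dart i.2) p.2) fun i =>
    (hE.finite_crossings (c.dart i.1) (c.dart i.2)).subset fun p hp => by
      by_contra h
      simp only [Set.mem_ofPred_eq] at h
      simp [h] at hp
  rw [Fintype.sum_prod_type] at h
  refine Eq.trans ?_ h
  exact finsum_comp_equiv (Equiv.prodProdProdComm (ZMod k) ℝ (ZMod k) ℝ)
    (f := fun q : (ZMod k × ZMod k) × (ℝ × ℝ) =>
      ∑ᶠ _ : E.IsCrossing (c.dart q.1.1) q.2.1 (c.dart q.1.2) q.2.2,
        E.crossingSign (c.dart q.1.1) q.2.1 (c.dart q.1.2) q.2.2)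

theorem cusps_eq_sum [NeZero k] (E : LegendrianEmbedding G) (hE : E.IsGenericFront)
    (c : ParamCycle G k) :
    E.cusps c = ∑ i, E.edgeCusps (c.dart i) + ∑ i, E.vertexCusp (c.dart i) (c.dart (i + 1)) := by
  classical
  rw [cusps]
  congr 1
  · exact ncard_prod_eq_sum (fun i => {t | E.IsEdgeCusp (c.dart i) t}) fun i =>
      hE.finite_cusps (c.dart i)
  · rw [Set.ncard_eq_toFinset_card', Set.toFinset_ofPred, Finset.card_filter]
    exact Finset.sum_congr rfl fun i _ => by rw [vertexCusp]

end LegendrianEmbedding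

/-! ### Embeddings with one or two prescribed values -/

theorem card_filter_embedding_perm {ι α : Type*} [Fintype (ι ↪ α)]
    (P : (ι ↪ α) → Prop) [DecidablePred P] (Q : (ι ↪ α) → Prop) [DecidablePred Q] (σ : Equiv.Perm α) (h : ∀ f, P f ↔ Q (f.trans σ.toEmbedding)) :
    (Finset.univ.filter P).card = (Finset.univ.filter Q).card := by
  refine Finset.card_equiv (Equiv.embeddingCongr (Equiv.refl ι) σ) fun f => ?_
  simp only [Finset.mem_filter, Finset.mem_univ, true_and]
  exact h f

section EmbeddingSums

variable {ι α : Type*} [Fintype ι] [Fintype α] [DecidableEq α]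

/-- Composing with a transposition shows that all values at `a` are taken equally often; the count
is the number of all embeddings divided by the size of the target. -/
theorem card_embedding_apply_eq (a : ι) (x : α) :
    (Finset.univ.filter fun f : ι ↪ α => f a = x).card =
      (Fintype.card α - 1).descFactorial (Fintype.card ι - 1) := by
  have hn : 0 < Fintype.card α := Fintype.card_pos_iff.2 ⟨x⟩
  have hr : 0 < Fintype.card ι := Fintype.card_pos_iff.2 ⟨a⟩
  have hconst : ∀ y, (Finset.univ.filter fun f : ι ↪ α => f a = y).card =
      (Finset.univ.filter fun f : ι ↪ α => f a = x).card := fun y =>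
    card_filter_embedding_perm _ _ (Equiv.swap y x) fun f => by
      simp [Equiv.swap_apply_eq_iff]
  have htot : Fintype.card α * (Finset.univ.filter fun f : ι ↪ α => f a = x).card =
      (Fintype.card α).descFactorial (Fintype.card ι) := by
    have h := Finset.card_eq_sum_card_fiberwise (s := Finset.univ) (f := fun f : ι ↪ α => f a)
      (t := Finset.univ) (fun _ _ => Finset.mem_coe.2 (Finset.mem_univ _))
    rw [Finset.sum_congr rfl fun y _ => hconst y, Finset.sum_const, smul_eq_mul] at h
    rw [← Fintype.card_embedding_eq, ← Finset.card_univ (α := ι ↪ α), h, Finset.card_univ]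
  obtain ⟨n, hn'⟩ := Nat.exists_eq_succ_of_ne_zero hn.ne'
  obtain ⟨r, hr'⟩ := Nat.exists_eq_succ_of_ne_zero hr.ne'
  rw [hn', hr', Nat.succ_eq_add_one, Nat.succ_eq_add_one, Nat.succ_descFactorial_succ] at htot
  rw [hn', hr']
  exact Nat.eq_of_mul_eq_mul_left n.succ_pos htot

theorem sum_embedding_apply (a : ι) (H : α → ℚ) :
    ∑ f : ι ↪ α, H (f a) =
      ((Fintype.card α - 1).descFactorial (Fintype.card ι - 1) : ℕ) * ∑ x, H x := by
  rw [← Finset.sum_fiberwise _ fun f : ι ↪ α => f a, Finset.mul_sum]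
  refine Finset.sum_congr rfl fun x _ => ?_
  rw [Finset.sum_congr rfl (g := fun _ => H x) fun f hf => by rw [(Finset.mem_filter.1 hf).2],
    Finset.sum_const, card_embedding_apply_eq, nsmul_eq_mul]

/-- The same argument inside the fibre over `x`: transpositions of values other than `x` preserve
this fibre and permute the possible values at `b`. -/
theorem card_embedding_apply_eq_apply_eq {a b : ι} (hab : a ≠ b) {x y : α} (hxy : x ≠ y) :
    (Finset.univ.filter fun f : ι ↪ α => f a = x ∧ f b = y).card =
      (Fintype.card α - 2).descFactorial (Fintype.card ι - 2) := by
  have hr : 1 < Fintype.card ι := Fintype.one_lt_card_iff.2 ⟨a, b, hab⟩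
  have hn : 1 < Fintype.card α := Fintype.one_lt_card_iff.2 ⟨x, y, hxy⟩
  have hconst : ∀ z ∈ Finset.univ.erase x,
      (Finset.univ.filter fun f : ι ↪ α => f a = x ∧ f b = z).card =
      (Finset.univ.filter fun f : ι ↪ α => f a = x ∧ f b = y).card := fun z hz =>
    card_filter_embedding_perm _ _ (Equiv.swap z y) fun f => by
      simp [Equiv.swap_apply_eq_iff,
        Equiv.swap_apply_of_ne_of_ne (Finset.ne_of_mem_erase hz).symm hxy]
  have htot : (Fintype.card α - 1) *
      (Finset.univ.filter fun f : ι ↪ α => f a = x ∧ f b = y).card =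
      (Fintype.card α - 1).descFactorial (Fintype.card ι - 1) := by
    have h := Finset.card_eq_sum_card_fiberwise (s := Finset.univ.filter fun f : ι ↪ α => f a = x)
      (f := fun f : ι ↪ α => f b) (t := Finset.univ.erase x) fun f hf => by
        have hf' : f a = x := by simpa using hf
        have : f b ≠ x := fun h => hab (f.injective (hf'.trans h.symm))
        simpa using this
    simp only [Finset.filter_filter] at h
    rw [Finset.sum_congr rfl hconst, Finset.sum_const, smul_eq_mul,
      Finset.card_erase_of_mem (Finset.mem_univ x), Finset.card_univ] at h
    rw [← card_embedding_apply_eq a x, h]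
  obtain ⟨n, hn'⟩ := Nat.exists_eq_add_of_le' hn
  obtain ⟨r, hr'⟩ := Nat.exists_eq_add_of_le' hr
  rw [hn', hr'] at htot ⊢
  change (n + 1) * _ = (n + 1).descFactorial (r + 1) at htot
  rw [Nat.succ_descFactorial_succ] at htot
  exact Nat.eq_of_mul_eq_mul_left n.succ_pos htot

theorem sum_embedding_apply_apply {a b : ι} (hab : a ≠ b) (H : α → α → ℚ) :
    ∑ f : ι ↪ α, H (f a) (f b) =
      ((Fintype.card α - 2).descFactorial (Fintype.card ι - 2) : ℕ) *
        ∑ x, ∑ y ∈ Finset.univ.erase x, H x y := by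
  rw [← Finset.sum_fiberwise _ fun f : ι ↪ α => f a, Finset.mul_sum]
  refine Finset.sum_congr rfl fun x _ => ?_
  rw [Finset.mul_sum, ← Finset.sum_fiberwise_of_maps_to (t := Finset.univ.erase x)
    (g := fun f : ι ↪ α => f b) fun f hf => by
      have hf' : f a = x := by simpa using hf
      have : f b ≠ x := fun h => hab (f.injective (hf'.trans h.symm))
      simpa using this]
  refine Finset.sum_congr rfl fun y hy => ?_
  rw [Finset.filter_filter, Finset.sum_congr rfl (g := fun _ => H x y) fun f hf => by
      rw [(Finset.mem_filter.1 hf).2.1, (Finset.mem_filter.1 hf).2.2],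
    Finset.sum_const, card_embedding_apply_eq_apply_eq hab (Finset.ne_of_mem_erase hy).symm,
    nsmul_eq_mul]

end EmbeddingSums

/-! ### The 2k parametrizations of a cycle -/

namespace ParamCycle

variable {V : Type*} {G : SimpleGraph V} {k : ℕ}

theorem vert_injective : Function.Injective (vert : ParamCycle G k → ZMod k → V) := by
  rintro ⟨v, _, _, _⟩ ⟨w, _, _, _⟩ h
  cases h
  rfl

theorem finite_of_finite [Finite V] : Finite (ParamCycle G k) := by
  -- `ZMod 0` is infinite, but there are no cycles of length 0.
  rcases Nat.eq_zero_or_pos k with rfl | hk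
  · have : IsEmpty (ParamCycle G 0) := ⟨fun c => by simpa using c.three_le⟩
    infer_instance
  · have : NeZero k := ⟨hk.ne'⟩
    exact Finite.of_injective _ vert_injective

/-- The same cycle with another starting vertex. -/
def rotate (c : ParamCycle G k) (a : ZMod k) : ParamCycle G k where
  vert i := c.vert (i + a)
  three_le := c.three_le
  injective _ _ h := add_right_cancel (c.injective h)
  adj i := by simpa only [add_right_comm] using c.adj (i + a)

/-- The same cycle traversed backwards, with another starting vertex. -/
def reflect (c : ParamCycle G k) (a : ZMod k) : ParamCycle G k where
  vert i := c.vert (a - i)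
  three_le := c.three_le
  injective _ _ h := sub_right_injective (c.injective h)
  adj i := by
    have h := (c.adj (a - (i + 1))).symm
    rwa [show a - (i + 1) + 1 = a - i by ring] at h

theorem rotate_rotate (c : ParamCycle G k) (a b : ZMod k) :
    (c.rotate a).rotate b = c.rotate (b + a) :=
  vert_injective (funext fun i => congrArg c.vert (add_assoc i b a))

theorem rotate_zero (c : ParamCycle G k) : c.rotate 0 = c :=
  vert_injective (funext fun i => congrArg c.vert (add_zero i))

theorem mk_rotate (c : ParamCycle G k) (a : ZMod k) :
    (Quotient.mk (setoid G k) (c.rotate a)) = Quotient.mk (setoid G k) c :=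
  (Quotient.sound (s := setoid G k) ⟨a, Or.inl fun _ => rfl⟩).symm

/-- All parametrizations of the cycle parametrized by `c`. -/
def reparam (c : ParamCycle G k) : ZMod k ⊕ ZMod k → ParamCycle G k :=
  Sum.elim c.rotate c.reflect

/-- If a rotation equalled a reflection, comparing the vertices at 0 and 1 would give 2 = 0 in `ZMod
k`, impossible for k ≥ 3. -/
theorem reparam_injective (c : ParamCycle G k) : Function.Injective c.reparam := by
  have h2 : (1 : ZMod k) + 1 ≠ 0 := fun h => by
    have h' : ((2 : ℕ) : ZMod k) = 0 := by rw [← h]; norm_num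
    have := Nat.le_of_dvd two_pos ((ZMod.natCast_eq_zero_iff 2 k).1 h')
    have := c.three_le
    omega
  have key : ∀ a b, c.rotate a ≠ c.reflect b := fun a b h => by
    have h0 : 0 + a = b - 0 := c.injective (congrFun (congrArg vert h) 0)
    have h1 : 1 + a = b - 1 := c.injective (congrFun (congrArg vert h) 1)
    apply h2
    linear_combination h1 - h0
  rintro (a | a) (b | b) h
  · have h0 : 0 + a = 0 + b := c.injective (congrFun (congrArg vert h) 0)
    rw [add_left_cancel h0]
  · exact (key a b h).elim
  · exact (key b a h.symm).elim
  · have h0 : a - 0 = b - 0 := c.injective (congrFun (congrArg vert h) 0)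
    rw [sub_left_injective h0]

theorem mk_eq_mk_iff (c c' : ParamCycle G k) :
    Quotient.mk (setoid G k) c' = Quotient.mk (setoid G k) c ↔ c' ∈ Set.range c.reparam := by
  rw [eq_comm, Quotient.eq]
  constructor
  · rintro ⟨a, h | h⟩
    · exact ⟨Sum.inl a, vert_injective (funext fun i => (h i).symm)⟩
    · exact ⟨Sum.inr a, vert_injective (funext fun i => (h i).symm)⟩
  · rintro ⟨a | a, rfl⟩
    · exact ⟨a, Or.inl fun _ => rfl⟩
    · exact ⟨a, Or.inr fun _ => rfl⟩

theorem sum_mk [Fintype (ParamCycle G k)] [Fintype (GraphCycle G k)] [NeZero k]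
    (F : GraphCycle G k → ℚ) :
    ∑ c : ParamCycle G k, F (Quotient.mk (setoid G k) c) = 2 * k * ∑ C, F C := by
  classical
  let π : ParamCycle G k → GraphCycle G k := Quotient.mk (setoid G k)
  change ∑ c : ParamCycle G k, F (π c) = _
  rw [← Finset.sum_fiberwise _ π, Finset.mul_sum]
  refine Finset.sum_congr rfl fun C _ => ?_
  refine (Finset.sum_congr rfl fun c hc => congrArg F (Finset.mem_filter.1 hc).2).trans ?_
  rw [Finset.sum_const, nsmul_eq_mul]
  congr 1
  obtain ⟨c, rfl⟩ := Quotient.exists_rep C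
  have : (Finset.univ.filter fun c' => π c' = π c) = Finset.univ.image c.reparam := by
    ext c'
    have h : π c' = π c ↔ _ := mk_eq_mk_iff c c'
    simpa using h
  change ((Finset.univ.filter fun c' => π c' = π c).card : ℚ) = _
  rw [this, Finset.card_image_of_injective _ c.reparam_injective, Finset.card_univ,
    Fintype.card_sum, ZMod.card]
  push_cast
  ring

end ParamCycle

/-! ### Even and odd residues modulo 2r -/

/-- Multiplication by two, `ℤ/r → ℤ/2r`. -/
def ZMod.doubleHom (r : ℕ) : ZMod r →+ ZMod (2 * r) :=
  ZMod.lift r ⟨zmultiplesHom (ZMod (2 * r)) 2, by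
    have := ZMod.natCast_self (2 * r)
    push_cast at this
    simpa [mul_comm] using this⟩

namespace ZMod

variable {r : ℕ}

theorem doubleHom_natCast (N : ℕ) : doubleHom r N = ((2 * N : ℕ) : ZMod (2 * r)) := by
  have := ZMod.lift_coe r ⟨zmultiplesHom (ZMod (2 * r)) 2, by
    have := ZMod.natCast_self (2 * r)
    push_cast at this
    simpa [mul_comm] using this⟩ (N : ℤ)
  simpa [doubleHom, mul_comm] using this

theorem doubleHom_add_one (j : ZMod r) : doubleHom r (j + 1) = doubleHom r j + 1 + 1 := by
  have := doubleHom_natCast (r := r) 1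
  rw [map_add, add_assoc]
  congr 1
  norm_num at this ⊢
  exact this

theorem doubleHom_injective [NeZero r] : Function.Injective (doubleHom r) := by
  refine (injective_iff_map_eq_zero _).2 fun j hj => ?_
  rw [← ZMod.natCast_zmod_val j, doubleHom_natCast, ZMod.natCast_eq_zero_iff] at hj
  rw [← ZMod.natCast_zmod_val j, ZMod.natCast_eq_zero_iff]
  exact Nat.dvd_of_mul_dvd_mul_left two_pos hj

theorem doubleHom_ne_add_one [NeZero r] (i j : ZMod r) : doubleHom r i ≠ doubleHom r j + 1 := by
  intro h
  rw [← ZMod.natCast_zmod_val i, ← ZMod.natCast_zmod_val j, doubleHom_natCast,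
    doubleHom_natCast] at h
  -- The congruence modulo 2r is weakened to one modulo 2, where the parities clash.
  have h' := ((ZMod.natCast_eq_natCast_iff (2 * i.val) (2 * j.val + 1) _).1
    (by simpa using h)).of_mul_right r
  unfold Nat.ModEq at h'
  omega

/-- `ℤ/2r` consists of its even and its odd elements. -/
noncomputable def evenOddEquiv (r : ℕ) [NeZero r] : ZMod r ⊕ ZMod r ≃ ZMod (2 * r) :=
  Equiv.ofBijective (Sum.elim (doubleHom r) fun j => doubleHom r j + 1) <| by
    rw [Fintype.bijective_iff_injective_and_card]
    constructor
    · rintro (i | i) (j | j) h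
      · exact congrArg _ (doubleHom_injective h)
      · exact (doubleHom_ne_add_one i j h).elim
      · exact (doubleHom_ne_add_one j i h.symm).elim
      · exact congrArg _ (doubleHom_injective (add_right_cancel h))
    · simp [ZMod.card, two_mul]

end ZMod

/-! ### Cycles of a complete bipartite graph as pairs of embeddings -/

namespace ParamCycle

variable {α β : Type*} {r k : ℕ}

/-- The cycle of a complete bipartite graph through the vertices `f 0, g 0, f 1, g 1, …`. -/
noncomputable def interleave [NeZero r] (hr : 2 ≤ r) (f : ZMod r ↪ α) (g : ZMod r ↪ β) :
    ParamCycle (completeBipartiteGraph α β) (2 * r) where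
  vert i := Sum.map f g ((ZMod.evenOddEquiv r).symm i)
  three_le := by omega
  injective := (f.injective.sumMap g.injective).comp (Equiv.injective _)
  adj i := by
    obtain ⟨x | x, rfl⟩ := (ZMod.evenOddEquiv r).surjective i
    · have h : ZMod.evenOddEquiv r (Sum.inl x) + 1 = ZMod.evenOddEquiv r (Sum.inr x) := rfl
      simp [h]
    · have h : ZMod.evenOddEquiv r (Sum.inr x) + 1 = ZMod.evenOddEquiv r (Sum.inl (x + 1)) :=
        (ZMod.doubleHom_add_one x).symm
      simp [h]

section

variable [NeZero r] (hr : 2 ≤ r) (f : ZMod r ↪ α) (g : ZMod r ↪ β)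

theorem interleave_vert_even (j : ZMod r) :
    (interleave hr f g).vert (ZMod.doubleHom r j) = Sum.inl (f j) :=
  congrArg (Sum.map f g) ((ZMod.evenOddEquiv r).symm_apply_apply (Sum.inl j))

theorem interleave_vert_odd (j : ZMod r) :
    (interleave hr f g).vert (ZMod.doubleHom r j + 1) = Sum.inr (g j) :=
  congrArg (Sum.map f g) ((ZMod.evenOddEquiv r).symm_apply_apply (Sum.inr j))

theorem interleave_injective : Function.Injective
    fun p : (ZMod r ↪ α) × (ZMod r ↪ β) => interleave hr p.1 p.2 := by
  rintro ⟨f, g⟩ ⟨f', g'⟩ h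
  have h' := congrFun (congrArg vert h)
  refine Prod.ext (DFunLike.ext _ _ fun j => ?_) (DFunLike.ext _ _ fun j => ?_)
  · have := h' (ZMod.doubleHom r j)
    simpa only [interleave_vert_even, Sum.inl.injEq] using this
  · have := h' (ZMod.doubleHom r j + 1)
    simpa only [interleave_vert_odd, Sum.inr.injEq] using this

end

theorem isLeft_vert_add_one (c : ParamCycle (completeBipartiteGraph α β) k) (i : ZMod k) :
    (c.vert (i + 1)).isLeft = !(c.vert i).isLeft := by
  have h := c.adj i
  revert h
  rcases c.vert i with a | a <;> rcases c.vert (i + 1) with b | b <;> simp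

theorem isLeft_vert_natCast (c : ParamCycle (completeBipartiteGraph α β) k)
    (h0 : (c.vert 0).isLeft) (N : ℕ) : (c.vert N).isLeft ↔ Even N := by
  induction N with
  | zero => simpa using h0
  | succ N ih => rw [Nat.cast_succ, isLeft_vert_add_one, Nat.even_add_one, ← ih]; simp

theorem isLeft_vert_zero_or_one (c : ParamCycle (completeBipartiteGraph α β) k) :
    (c.vert 0).isLeft ∨ (c.vert 1).isLeft := by
  have := c.isLeft_vert_add_one 0
  rw [zero_add] at this
  rw [this]
  cases (c.vert 0).isLeft <;> simp

theorem exists_eq_interleave [NeZero r] (hr : 2 ≤ r)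
    (c : ParamCycle (completeBipartiteGraph α β) (2 * r)) (h0 : (c.vert 0).isLeft) :
    ∃ p : (ZMod r ↪ α) × (ZMod r ↪ β), interleave hr p.1 p.2 = c := by
  have hf : ∀ j : ZMod r, ∃ x, c.vert (ZMod.doubleHom r j) = Sum.inl x := fun j => by
    rw [← ZMod.natCast_zmod_val j, ZMod.doubleHom_natCast]
    exact Sum.isLeft_iff.1 ((c.isLeft_vert_natCast h0 _).2 (even_two_mul _))
  choose f hf using hf
  have hg : ∀ j : ZMod r, ∃ x, c.vert (ZMod.doubleHom r j + 1) = Sum.inr x := fun j => by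
    refine Sum.isRight_iff.1 ?_
    rw [← Sum.not_isLeft, isLeft_vert_add_one, hf]
    simp
  choose g hg using hg
  have hf' : Function.Injective f := fun i j h => ZMod.doubleHom_injective (c.injective (by
    rw [hf, hf, h]))
  have hg' : Function.Injective g := fun i j h =>
    ZMod.doubleHom_injective (add_right_cancel (c.injective (by rw [hg, hg, h])))
  refine ⟨(⟨f, hf'⟩, ⟨g, hg'⟩), vert_injective (funext fun i => ?_)⟩
  obtain ⟨j | j, rfl⟩ := (ZMod.evenOddEquiv r).surjective i
  · exact (interleave_vert_even hr ⟨f, hf'⟩ ⟨g, hg'⟩ j).trans (hf j).symm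
  · exact (interleave_vert_odd hr ⟨f, hf'⟩ ⟨g, hg'⟩ j).trans (hg j).symm

/-- The sides alternate, and k steps lead back to the start; so k is even whenever the start lies on
the left, which a rotation by one can arrange. -/
theorem isEmpty_of_odd (hk : Odd k) : IsEmpty (ParamCycle (completeBipartiteGraph α β) k) := by
  have key : ∀ c : ParamCycle (completeBipartiteGraph α β) k, ¬(c.vert 0).isLeft := fun c h0 => by
    have h := (c.isLeft_vert_natCast h0 k).1 (by rwa [ZMod.natCast_self])
    exact Nat.not_even_iff_odd.2 hk h
  refine ⟨fun c => ?_⟩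
  rcases c.isLeft_vert_zero_or_one with h | h
  · exact key c h
  · exact key (c.rotate 1) (by simpa [rotate] using h)

/-- The Boolean records the side of the starting vertex: after rotation by -1 the cycle starts on
the right. -/
theorem bijective_rotate_interleave [NeZero r] (hr : 2 ≤ r) : Function.Bijective
    fun p : Bool × ((ZMod r ↪ α) × (ZMod r ↪ β)) =>
      (interleave hr p.2.1 p.2.2).rotate (if p.1 then -1 else 0) := by
  have h0 : ∀ p : (ZMod r ↪ α) × (ZMod r ↪ β), ((interleave hr p.1 p.2).vert 0).isLeft :=
    fun p => by
      have := interleave_vert_even hr p.1 p.2 0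
      rw [map_zero] at this
      simp [this]
  have h1 : ∀ p : (ZMod r ↪ α) × (ZMod r ↪ β), ((interleave hr p.1 p.2).vert (-1)).isLeft = false :=
    fun p => by
      have := isLeft_vert_add_one (interleave hr p.1 p.2) (-1)
      rw [neg_add_cancel, h0] at this
      simpa using this.symm
  constructor
  · rintro ⟨b, p⟩ ⟨b', p'⟩ h
    have hb : b = b' := by
      have h' := congrArg Sum.isLeft (congrFun (congrArg vert h) 0)
      simp only [rotate, zero_add] at h'
      have e : ∀ q : (ZMod r ↪ α) × (ZMod r ↪ β), ∀ a : Bool,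
          ((interleave hr q.1 q.2).vert (if a then -1 else 0)).isLeft = !a := fun q a => by
        cases a
        · exact h0 q
        · exact h1 q
      rw [e p, e p'] at h'
      exact Bool.not_inj h'
    subst hb
    have := congrArg (fun c => rotate c (if b then 1 else 0)) h
    rw [Prod.mk.injEq]
    refine ⟨rfl, interleave_injective hr ?_⟩
    cases b <;> simpa [rotate_rotate, rotate_zero] using this
  · intro c
    rcases c.isLeft_vert_zero_or_one with h | h
    · obtain ⟨p, hp⟩ := exists_eq_interleave hr c h
      exact ⟨(false, p), by simpa [rotate_zero] using hp⟩
    · obtain ⟨p, hp⟩ := exists_eq_interleave hr (c.rotate 1) (by simpa [rotate] using h)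
      exact ⟨(true, p), by simp [hp, rotate_rotate, rotate_zero]⟩

end ParamCycle

theorem GraphCycle.finite_of_finite {V : Type*} [Finite V] {G : SimpleGraph V} {k : ℕ} :
    Finite (GraphCycle G k) :=
  have : Finite (ParamCycle G k) := ParamCycle.finite_of_finite
  Quotient.finite _

/-- A 2r-cycle has 4r parametrizations, half of them starting on the left; `tb` does not see the
rotation, so both halves contribute equally. -/
theorem LegendrianEmbedding.two_mul_TBLen {α β : Type*} [Fintype α] [Fintype β] {r : ℕ} [NeZero r]
    (hr : 2 ≤ r) (E : LegendrianEmbedding (completeBipartiteGraph α β)) :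
    2 * r * E.TBLen (2 * r) = ∑ f : ZMod r ↪ α, ∑ g : ZMod r ↪ β,
      E.tbParam (ParamCycle.interleave hr f g) := by
  classical
  have : Finite (ParamCycle (completeBipartiteGraph α β) (2 * r)) := ParamCycle.finite_of_finite
  have : Finite (GraphCycle (completeBipartiteGraph α β) (2 * r)) := GraphCycle.finite_of_finite
  have := Fintype.ofFinite (ParamCycle (completeBipartiteGraph α β) (2 * r))
  have := Fintype.ofFinite (GraphCycle (completeBipartiteGraph α β) (2 * r))
  have h1 := ParamCycle.sum_mk (G := completeBipartiteGraph α β) (k := 2 * r) E.tb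
  rw [← (ParamCycle.bijective_rotate_interleave hr).sum_comp] at h1
  simp only [ParamCycle.mk_rotate] at h1
  rw [Fintype.sum_prod_type, Fintype.sum_bool, Fintype.sum_prod_type, ← two_mul] at h1
  rw [TBLen, finsum_eq_sum_of_fintype]
  push_cast at h1
  change 2 * ∑ f : ZMod r ↪ α, ∑ g : ZMod r ↪ β, E.tbParam (ParamCycle.interleave hr f g) = _ at h1
  linear_combination -h1 / 2

/-! ### Sums over pairs of embeddings, by coincidence pattern of the positions -/

section BipartiteSums

variable {ι α β : Type*} [Fintype ι] [Fintype α] [Fintype β] [DecidableEq α] [DecidableEq β]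

theorem sum_embeddings_apply (H : α → β → ℚ) (a b : ι) :
    ∑ f : ι ↪ α, ∑ g : ι ↪ β, H (f a) (g b) =
      ((Fintype.card α - 1).descFactorial (Fintype.card ι - 1) : ℕ) *
      ((Fintype.card β - 1).descFactorial (Fintype.card ι - 1) : ℕ) * ∑ x, ∑ y, H x y := by
  simp only [sum_embedding_apply b (H _)]
  rw [← Finset.mul_sum, sum_embedding_apply a fun x => ∑ y, H x y]
  ring

theorem sum_embeddings_apply_right (H : α → β → β → ℚ) (a : ι) {b c : ι} (hbc : b ≠ c) :
    ∑ f : ι ↪ α, ∑ g : ι ↪ β, H (f a) (g b) (g c) =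
      ((Fintype.card α - 1).descFactorial (Fintype.card ι - 1) : ℕ) *
      ((Fintype.card β - 2).descFactorial (Fintype.card ι - 2) : ℕ) *
      ∑ x, ∑ y, ∑ y' ∈ Finset.univ.erase y, H x y y' := by
  simp only [sum_embedding_apply_apply hbc (H _)]
  rw [← Finset.mul_sum, sum_embedding_apply a fun x => ∑ y, ∑ y' ∈ Finset.univ.erase y, H x y y']
  ring

theorem sum_embeddings_apply_left (H : α → α → β → ℚ) {a c : ι} (hac : a ≠ c) (b : ι) :
    ∑ f : ι ↪ α, ∑ g : ι ↪ β, H (f a) (f c) (g b) =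
      ((Fintype.card α - 2).descFactorial (Fintype.card ι - 2) : ℕ) *
      ((Fintype.card β - 1).descFactorial (Fintype.card ι - 1) : ℕ) *
      ∑ x, ∑ x' ∈ Finset.univ.erase x, ∑ y, H x x' y := by
  simp only [sum_embedding_apply b (H _ _)]
  rw [sum_embedding_apply_apply hac (fun x x' => _ * ∑ y, H x x' y)]
  simp only [← Finset.mul_sum]
  ring

theorem sum_embeddings_apply_both (H : α → α → β → β → ℚ) {a c : ι} (hac : a ≠ c) {b d : ι}
    (hbd : b ≠ d) :
    ∑ f : ι ↪ α, ∑ g : ι ↪ β, H (f a) (f c) (g b) (g d) =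
      ((Fintype.card α - 2).descFactorial (Fintype.card ι - 2) : ℕ) *
      ((Fintype.card β - 2).descFactorial (Fintype.card ι - 2) : ℕ) *
      ∑ x, ∑ x' ∈ Finset.univ.erase x, ∑ y, ∑ y' ∈ Finset.univ.erase y, H x x' y y' := by
  simp only [sum_embedding_apply_apply hbd (H _ _)]
  rw [sum_embedding_apply_apply hac
    (fun x x' => _ * ∑ y, ∑ y' ∈ Finset.univ.erase y, H x x' y y')]
  simp only [← Finset.mul_sum]
  ring

end BipartiteSums

theorem ZMod.self_ne_add_one {r : ℕ} (hr : 2 ≤ r) (i : ZMod r) : i ≠ i + 1 := by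
  have : Fact (1 < r) := ⟨hr⟩
  simp

/-! ### The total writhe of all interleaved cycles -/

section

variable {r : ℕ} [NeZero r]

theorem ZMod.sum_two_mul {M : Type*} [AddCommMonoid M] (F : ZMod (2 * r) → M) :
    ∑ i, F i = ∑ j, F (doubleHom r j) + ∑ j, F (doubleHom r j + 1) := by
  rw [← (evenOddEquiv r).sum_comp, Fintype.sum_sum_type]
  rfl

variable {n m : ℕ} (hr : 2 ≤ r) (f : ZMod r ↪ Fin n) (g : ZMod r ↪ Fin m)

theorem ParamCycle.interleave_dart_even (j : ZMod r) :
    (interleave hr f g).dart (ZMod.doubleHom r j) = dartPQ (f j) (g j) := by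
  apply SimpleGraph.Dart.ext
  simp only [dart, dartPQ, interleave_vert_even, interleave_vert_odd]

theorem ParamCycle.interleave_dart_odd (j : ZMod r) :
    (interleave hr f g).dart (ZMod.doubleHom r j + 1) = (dartPQ (f (j + 1)) (g j)).symm := by
  apply SimpleGraph.Dart.ext
  simp only [dart, dartPQ, ← ZMod.doubleHom_add_one, interleave_vert_even, interleave_vert_odd,
    SimpleGraph.Dart.symm, Prod.swap]

namespace LegendrianEmbedding

variable (E : LegendrianEmbedding (completeBipartiteGraph (Fin n) (Fin m)))

/-- The signed sum of the crossings at which `p q` passes over `p' q'`, both edges being oriented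
from `P` to `Q`. -/
noncomputable def overPQ (p p' : Fin n) (q q' : Fin m) : ℚ :=
  E.overWrithe (dartPQ p q) (dartPQ p' q')

/-- The edges of the cycle alternate in direction between P and Q; a minus sign marks the pairs in
which exactly one edge runs from Q to P. -/
theorem writhe_interleave (hE : E.IsGenericFront) :
    (E.writhe (ParamCycle.interleave hr f g) : ℚ) = ∑ i, ∑ j,
      (E.overPQ (f i) (f j) (g i) (g j) - E.overPQ (f i) (f (j + 1)) (g i) (g j)
        - E.overPQ (f (i + 1)) (f j) (g i) (g j)
        + E.overPQ (f (i + 1)) (f (j + 1)) (g i) (g j)) := by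
  rw [E.writhe_eq_sum hE]
  simp only [ZMod.sum_two_mul, ParamCycle.interleave_dart_even, ParamCycle.interleave_dart_odd,
    overWrithe_symm_left, overWrithe_symm_right, overPQ]
  push_cast
  simp only [← Finset.sum_add_distrib]
  refine Finset.sum_congr rfl fun i _ => Finset.sum_congr rfl fun j _ => ?_
  ring

theorem cusps_interleave (hE : E.IsGenericFront) :
    (E.cusps (ParamCycle.interleave hr f g) : ℚ) = ∑ i,
      (E.edgeCusps (dartPQ (f i) (g i)) + E.edgeCusps (dartPQ (f (i + 1)) (g i))
        + E.vertexCusp (dartPQ (f i) (g i)) (dartPQ (f (i + 1)) (g i)).symm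
        + E.vertexCusp (dartPQ (f (i + 1)) (g i)).symm (dartPQ (f (i + 1)) (g (i + 1))) : ℚ) := by
  rw [E.cusps_eq_sum hE]
  simp only [ZMod.sum_two_mul, ← ZMod.doubleHom_add_one, ParamCycle.interleave_dart_even,
    ParamCycle.interleave_dart_odd, edgeCusps_symm]
  push_cast
  simp only [← Finset.sum_add_distrib]
  refine Finset.sum_congr rfl fun i _ => ?_
  ring

end LegendrianEmbedding

/-- After exchanging sums, each term is determined by the coincidences among the positions. Unless j
is i or i ± 1, all four terms are of the disjoint type and cancel in pairs, so each i leaves an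
amount independent of i. -/
theorem sum_embeddings_writhe (hr : 2 ≤ r) (H : Fin n → Fin n → Fin m → Fin m → ℚ) :
    ∑ f : ZMod r ↪ Fin n, ∑ g : ZMod r ↪ Fin m, ∑ i, ∑ j,
      (H (f i) (f j) (g i) (g j) - H (f i) (f (j + 1)) (g i) (g j)
        - H (f (i + 1)) (f j) (g i) (g j) + H (f (i + 1)) (f (j + 1)) (g i) (g j)) =
    2 * r * (
      ((n - 1).descFactorial (r - 1) * (m - 1).descFactorial (r - 1) : ℕ) * ∑ p, ∑ q, H p p q q
      - ((n - 1).descFactorial (r - 1) * (m - 2).descFactorial (r - 2) : ℕ) *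
          ∑ p, ∑ q, ∑ q' ∈ Finset.univ.erase q, H p p q q'
      - ((n - 2).descFactorial (r - 2) * (m - 1).descFactorial (r - 1) : ℕ) *
          ∑ p, ∑ p' ∈ Finset.univ.erase p, ∑ q, H p p' q q
      + ((n - 2).descFactorial (r - 2) * (m - 2).descFactorial (r - 2) : ℕ) *
          ∑ p, ∑ p' ∈ Finset.univ.erase p, ∑ q, ∑ q' ∈ Finset.univ.erase q, H p p' q q') := by
  set Xe : ℚ :=
    ((n - 1).descFactorial (r - 1) * (m - 1).descFactorial (r - 1) : ℕ) * ∑ p, ∑ q, H p p q q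
    with hXe
  set XP : ℚ := ((n - 1).descFactorial (r - 1) * (m - 2).descFactorial (r - 2) : ℕ) *
    ∑ p, ∑ q, ∑ q' ∈ Finset.univ.erase q, H p p q q' with hXP
  set XQ : ℚ := ((n - 2).descFactorial (r - 2) * (m - 1).descFactorial (r - 1) : ℕ) *
    ∑ p, ∑ p' ∈ Finset.univ.erase p, ∑ q, H p p' q q with hXQ
  set XN : ℚ := ((n - 2).descFactorial (r - 2) * (m - 2).descFactorial (r - 2) : ℕ) *
    ∑ p, ∑ p' ∈ Finset.univ.erase p, ∑ q, ∑ q' ∈ Finset.univ.erase q, H p p' q q' with hXN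
  let Z (a c b d : ZMod r) : ℚ :=
    ∑ f : ZMod r ↪ Fin n, ∑ g : ZMod r ↪ Fin m, H (f a) (f c) (g b) (g d)
  have he : ∀ a b, Z a a b b = Xe := fun a b => by
    simpa [ZMod.card, hXe] using sum_embeddings_apply (fun p q => H p p q q) a b
  have hP : ∀ a b d, b ≠ d → Z a a b d = XP := fun a b d h => by
    simpa [ZMod.card, hXP] using sum_embeddings_apply_right (fun p q q' => H p p q q') a h
  have hQ : ∀ a c b, a ≠ c → Z a c b b = XQ := fun a c b h => by
    simpa [ZMod.card, hXQ] using sum_embeddings_apply_left (fun p p' q => H p p' q q) h b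
  have hN : ∀ a c b d, a ≠ c → b ≠ d → Z a c b d = XN := fun a c b d h h' => by
    simpa [ZMod.card, hXN] using sum_embeddings_apply_both H h h'
  -- The indicators of j = i - 1 and j = i + 1 are added rather than treated as exclusive cases: for
  -- r = 2 the two positions agree and both contribute.
  have key : ∀ i j, Z i j i j - Z i (j + 1) i j - Z (i + 1) j i j + Z (i + 1) (j + 1) i j =
      (if j = i then 2 * Xe - 2 * XQ else 0) + (if j = i - 1 then XN - XP else 0)
        + (if j = i + 1 then XN - XP else 0) := fun i j => by
    have h1 := ZMod.self_ne_add_one hr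
    have h2 : ∀ i : ZMod r, i ≠ i - 1 := fun i h => h1 (i - 1) (by
      rw [sub_add_cancel]; exact h.symm)
    by_cases hij : j = i
    · subst hij
      rw [he, he, hQ _ _ _ (h1 j), hQ _ _ _ (h1 j).symm, if_pos rfl, if_neg (h2 j),
        if_neg (h1 j)]
      ring
    · have hij' : i ≠ j := Ne.symm hij
      rw [if_neg hij, hN i j i j hij' hij', hN (i + 1) (j + 1) i j (by simpa using hij') hij']
      have e2 : Z i (j + 1) i j = if j = i - 1 then XP else XN := by
        split_ifs with h
        · have : j + 1 = i := by rw [h]; ring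
          rw [this, hP _ _ _ hij']
        · exact hN _ _ _ _ (fun h' => h (by rw [h']; ring)) hij'
      have e3 : Z (i + 1) j i j = if j = i + 1 then XP else XN := by
        split_ifs with h
        · rw [← h, hP _ _ _ hij']
        · exact hN _ _ _ _ (Ne.symm h) hij'
      rw [e2, e3]
      split_ifs <;> ring
  have hsum : ∑ f : ZMod r ↪ Fin n, ∑ g : ZMod r ↪ Fin m, ∑ i, ∑ j,
      (H (f i) (f j) (g i) (g j) - H (f i) (f (j + 1)) (g i) (g j)
        - H (f (i + 1)) (f j) (g i) (g j) + H (f (i + 1)) (f (j + 1)) (g i) (g j)) =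
      ∑ i, ∑ j, (Z i j i j - Z i (j + 1) i j - Z (i + 1) j i j + Z (i + 1) (j + 1) i j) := by
    simp only [Z, ← Finset.sum_sub_distrib, ← Finset.sum_add_distrib]
    -- Fixing both index sets makes `Finset.sum_comm` a one-way rewrite, moving the sums over
    -- positions outwards.
    simp only [Finset.sum_comm (s := (Finset.univ : Finset (ZMod r ↪ Fin m)))
      (t := (Finset.univ : Finset (ZMod r)))]
    simp only [Finset.sum_comm (s := (Finset.univ : Finset (ZMod r ↪ Fin n)))
      (t := (Finset.univ : Finset (ZMod r)))]
  rw [hsum]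
  simp only [key, Finset.sum_add_distrib, Finset.sum_ite_eq', Finset.mem_univ, if_true,
    Finset.sum_const, Finset.card_univ, ZMod.card, nsmul_eq_mul]
  ring

end

/-! ### The front counts as sums over ordered pairs -/

theorem sum_sum_Ioi_add_swap {ι M : Type*} [Fintype ι] [LinearOrder ι] [LocallyFiniteOrderTop ι]
    [LocallyFiniteOrderBot ι] [AddCommMonoid M] (f : ι → ι → M) :
    ∑ i, ∑ j ∈ Finset.Ioi i, (f i j + f j i) = ∑ i, ∑ j ∈ Finset.univ.erase i, f i j := by
  simpa [Finset.compl_singleton] using Finset.sum_sum_Ioi_add_eq_sum_sum_off_diag fun i j => f j i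

theorem sum_erase_comm {ι M : Type*} [Fintype ι] [DecidableEq ι] [AddCommMonoid M]
    (f : ι → ι → M) :
    ∑ i, ∑ j ∈ Finset.univ.erase i, f j i = ∑ i, ∑ j ∈ Finset.univ.erase i, f i j :=
  Finset.sum_comm' fun i j => by simp [ne_comm]

namespace LegendrianEmbedding

variable {n m : ℕ} (E : LegendrianEmbedding (completeBipartiteGraph (Fin n) (Fin m)))

theorem wE_eq_sum : (E.wE : ℚ) = ∑ p, ∑ q, E.overPQ p p q q := by
  simp [wE, overPQ, edgeWrithe]

/-- The two halves of `pairWrithe` are the two orders of the pair; the sign appears because one of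
the edges is reversed to run coherently. -/
theorem wAdjP_eq_sum :
    (E.wAdjP : ℚ) = -∑ p, ∑ q, ∑ q' ∈ Finset.univ.erase q, E.overPQ p p q q' := by
  simp only [← sum_sum_Ioi_add_swap, wAdjP, overPQ, pairWrithe, overWrithe_symm_left,
    overWrithe_symm_right]
  push_cast
  simp only [← Finset.sum_neg_distrib, neg_add]

theorem wAdjQ_eq_sum :
    (E.wAdjQ : ℚ) = -∑ p, ∑ p' ∈ Finset.univ.erase p, ∑ q, E.overPQ p p' q q := by
  rw [← sum_sum_Ioi_add_swap]
  simp only [← Finset.sum_add_distrib, wAdjQ, overPQ, pairWrithe, overWrithe_symm_left,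
    overWrithe_symm_right]
  push_cast
  rw [Finset.sum_comm]
  simp only [Finset.sum_comm (s := (Finset.univ : Finset (Fin m))), ← Finset.sum_neg_distrib,
    neg_add]

theorem wNonadj_eq_sum :
    (E.wNonadj : ℚ) = ∑ p, ∑ p' ∈ Finset.univ.erase p, ∑ q, ∑ q' ∈ Finset.univ.erase q,
      E.overPQ p p' q q' := by
  rw [← sum_sum_Ioi_add_swap]
  simp only [wNonadj, overPQ, pairWrithe]
  push_cast
  refine Finset.sum_congr rfl fun p _ => Finset.sum_congr rfl fun p' _ => ?_
  simp only [Finset.sum_add_distrib]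
  congr 1
  exact sum_erase_comm fun q q' => (E.overWrithe (dartPQ p' q) (dartPQ p q') : ℚ)

/-- A corner is a cusp in either direction of travel, so ordered pairs count it twice. -/
theorem two_mul_cVertP : 2 * (E.cVertP : ℚ) = ∑ p, ∑ q, ∑ q' ∈ Finset.univ.erase q,
    (E.vertexCusp (dartPQ p q).symm (dartPQ p q') : ℚ) := by
  simp only [← sum_sum_Ioi_add_swap, cVertP]
  push_cast
  simp only [Finset.mul_sum]
  refine Finset.sum_congr rfl fun p _ => Finset.sum_congr rfl fun q _ =>
    Finset.sum_congr rfl fun q' _ => ?_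
  have h := E.vertexCusp_symm (dartPQ p q).symm (dartPQ p q')
  rw [SimpleGraph.Dart.symm_symm] at h
  rw [h, two_mul]

theorem two_mul_cVertQ : 2 * (E.cVertQ : ℚ) = ∑ p, ∑ p' ∈ Finset.univ.erase p, ∑ q,
    (E.vertexCusp (dartPQ p q) (dartPQ p' q).symm : ℚ) := by
  rw [← sum_sum_Ioi_add_swap]
  simp only [← Finset.sum_add_distrib, cVertQ]
  push_cast
  rw [Finset.sum_comm]
  simp only [Finset.sum_comm (s := (Finset.univ : Finset (Fin m))), Finset.mul_sum]
  refine Finset.sum_congr rfl fun p _ => Finset.sum_congr rfl fun p' _ =>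
    Finset.sum_congr rfl fun q _ => ?_
  have h := E.vertexCusp_symm (dartPQ p q) (dartPQ p' q).symm
  rw [SimpleGraph.Dart.symm_symm] at h
  rw [h, two_mul]

/-- The factor r counts the positions. The factor 2 comes from the two edges per position and, for
corners, from counting ordered pairs. -/
theorem sum_cusps_interleave {r : ℕ} [NeZero r] (hr : 2 ≤ r) (hE : E.IsGenericFront) :
    ∑ f : ZMod r ↪ Fin n, ∑ g : ZMod r ↪ Fin m, (E.cusps (ParamCycle.interleave hr f g) : ℚ) =
    2 * r * (
      ((n - 1).descFactorial (r - 1) * (m - 1).descFactorial (r - 1) : ℕ) * E.cE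
      + ((n - 1).descFactorial (r - 1) * (m - 2).descFactorial (r - 2) : ℕ) * E.cVertP
      + ((n - 2).descFactorial (r - 2) * (m - 1).descFactorial (r - 1) : ℕ) * E.cVertQ) := by
  have h1 := ZMod.self_ne_add_one hr
  have he := sum_embeddings_apply (ι := ZMod r) fun (p : Fin n) (q : Fin m) =>
    (E.edgeCusps (dartPQ p q) : ℚ)
  have hP := fun a i => sum_embeddings_apply_right (fun (p : Fin n) (q q' : Fin m) =>
    (E.vertexCusp (dartPQ p q).symm (dartPQ p q') : ℚ)) a (h1 i)
  have hQ := fun i => sum_embeddings_apply_left (fun (p p' : Fin n) (q : Fin m) =>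
    (E.vertexCusp (dartPQ p q) (dartPQ p' q).symm : ℚ)) (h1 i)
  simp only [E.cusps_interleave hr _ _ hE]
  simp only [Finset.sum_comm (s := (Finset.univ : Finset (ZMod r ↪ Fin m)))
    (t := (Finset.univ : Finset (ZMod r)))]
  simp only [Finset.sum_comm (s := (Finset.univ : Finset (ZMod r ↪ Fin n)))
    (t := (Finset.univ : Finset (ZMod r))), Finset.sum_add_distrib, he, hP, hQ,
    ← two_mul_cVertP, ← two_mul_cVertQ, Finset.sum_const, Finset.card_univ, ZMod.card,
    Fintype.card_fin, nsmul_eq_mul]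
  simp only [cE]
  push_cast
  ring

end LegendrianEmbedding

/-! ### The common factor and the conclusion -/

theorem cycleFactor_eq_descFactorial {n m r : ℕ} (hr : 2 ≤ r) (hrm : r ≤ m) (hmn : m ≤ n) :
    cycleFactor n m r = ((n - 2).descFactorial (r - 2) * (m - 2).descFactorial (r - 2) : ℕ) := by
  have h : ∀ k, r ≤ k →
      ((k - 2).factorial : ℚ) = (k - r).factorial * (k - 2).descFactorial (r - 2) := fun k hk => by
    rw [← Nat.factorial_mul_descFactorial (n := k - 2) (k := r - 2) (by omega),
      show k - 2 - (r - 2) = k - r by omega]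
    push_cast
    rfl
  rw [cycleFactor, h m hrm, h n (hrm.trans hmn)]
  have := Nat.cast_ne_zero (R := ℚ).2 (m - r).factorial_ne_zero
  have := Nat.cast_ne_zero (R := ℚ).2 (n - r).factorial_ne_zero
  field_simp
  push_cast
  ring

theorem pred_descFactorial_pred {n r : ℕ} (hr : 2 ≤ r) (hn : 2 ≤ n) :
    ((n - 1).descFactorial (r - 1) : ℚ) = (n - 1) * (n - 2).descFactorial (r - 2) := by
  obtain ⟨n, rfl⟩ := Nat.exists_eq_add_of_le' hn
  obtain ⟨r, rfl⟩ := Nat.exists_eq_add_of_le' hr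
  change ((n + 1).descFactorial (r + 1) : ℚ) = _ * (n.descFactorial r : ℚ)
  rw [Nat.succ_descFactorial_succ]
  push_cast
  ring

namespace LegendrianEmbedding

variable {n m : ℕ} (E : LegendrianEmbedding (completeBipartiteGraph (Fin n) (Fin m)))

theorem TBLen_two_mul_eq (hE : E.IsGenericFront) {r : ℕ} (hr : 2 ≤ r) (hrm : r ≤ m)
    (hmn : m ≤ n) : E.TBLen (2 * r) = cycleFactor n m r * E.frontCount := by
  have : NeZero r := ⟨by omega⟩
  have hr0 : (2 * r : ℚ) ≠ 0 := mul_ne_zero two_ne_zero (NeZero.ne _)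
  refine mul_left_cancel₀ hr0 ?_
  rw [E.two_mul_TBLen hr]
  simp only [tbParam, Finset.sum_sub_distrib, ← Finset.mul_sum, E.sum_cusps_interleave hr hE,
    E.writhe_interleave hr _ _ hE, sum_embeddings_writhe hr E.overPQ]
  rw [cycleFactor_eq_descFactorial hr hrm hmn, frontCount, wE_eq_sum, wAdjP_eq_sum, wAdjQ_eq_sum,
    wNonadj_eq_sum]
  push_cast
  rw [pred_descFactorial_pred hr (hr.trans (hrm.trans hmn)),
    pred_descFactorial_pred hr (hr.trans hrm)]
  ring

theorem TBLen_of_odd {k : ℕ} (hk : Odd k) : E.TBLen k = 0 := by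
  have := ParamCycle.isEmpty_of_odd (α := Fin n) (β := Fin m) hk
  have : IsEmpty (GraphCycle (completeBipartiteGraph (Fin n) (Fin m)) k) :=
    Quotient.instIsEmpty
  exact finsum_of_isEmpty _

/-- Odd cycles do not exist, and a 2r-cycle embeds `ZMod r` into Q, which forces r ≤ m. -/
theorem TB_eq_sum_TBLen : E.TB = ∑ r ∈ Finset.Icc 2 m, E.TBLen (2 * r) := by
  let G := completeBipartiteGraph (Fin n) (Fin m)
  let e : (Σ r : Finset.Icc 2 m, GraphCycle G (2 * r)) → Σ k, GraphCycle G k :=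
    fun C => ⟨2 * C.1, C.2⟩
  have he : Function.Bijective e := by
    constructor
    · rintro ⟨⟨r, hr⟩, C⟩ ⟨⟨r', hr'⟩, C'⟩ h
      obtain ⟨h1, h2⟩ := Sigma.mk.inj_iff.1 h
      obtain rfl : r = r' := by simpa using h1
      have h2 : C = C' := eq_of_heq h2
      rw [h2]
    · rintro ⟨k, C⟩
      obtain ⟨c, rfl⟩ := Quotient.exists_rep C
      rcases Nat.even_or_odd' k with ⟨r, rfl | rfl⟩
      · have hr : 2 ≤ r := by have := c.three_le; omega
        have : NeZero r := ⟨by omega⟩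
        obtain ⟨p, -⟩ := (ParamCycle.bijective_rotate_interleave hr).surjective c
        have hrm : r ≤ m := by
          simpa [ZMod.card] using Fintype.card_le_of_embedding p.2.2
        exact ⟨⟨⟨r, Finset.mem_Icc.2 ⟨hr, hrm⟩⟩, Quotient.mk _ c⟩, rfl⟩
      · exact ((ParamCycle.isEmpty_of_odd (odd_two_mul_add_one r)).false c).elim
  have hfin : ∀ k, Finite (GraphCycle G k) := fun k => GraphCycle.finite_of_finite
  have hfin' := fun k => Fintype.ofFinite (GraphCycle G k)
  rw [TB, ← finsum_eq_of_bijective e he (f := fun C => E.tb C.2) fun _ => rfl,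
    finsum_eq_sum_of_fintype, Fintype.sum_sigma,
    ← Finset.sum_coe_sort (Finset.Icc 2 m) fun r => E.TBLen (2 * r)]
  exact Finset.sum_congr rfl fun r _ => (finsum_eq_sum_of_fintype _).symm

end LegendrianEmbedding

theorem mainTheorem2 (n m : ℕ) (hm : 3 ≤ m) (hnm : m ≤ n)
    (E : LegendrianEmbedding (completeBipartiteGraph (Fin n) (Fin m)))
    (hE : E.IsGenericFront) :
    (∀ r, 2 ≤ r → r ≤ m →
      (∃ N : ℕ, cycleFactor n m r = N) ∧
      E.TBLen (2 * r) = cycleFactor n m r * E.TBLen 4 ∧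
      E.TBLen (2 * r) = cycleFactor n m r * E.frontCount) ∧
    (∀ k, Odd k → E.TBLen k = 0) ∧
    E.TB = E.TBLen 4 * ∑ r ∈ Finset.Icc 2 m, cycleFactor n m r ∧
    E.TBLen 4 = E.frontCount := by
  have h4 : E.TBLen 4 = E.frontCount := by
    -- For r = 2 both descending factorials have length 0, so the factor is 1.
    rw [show 4 = 2 * 2 from rfl, E.TBLen_two_mul_eq hE le_rfl (by omega) hnm,
      cycleFactor_eq_descFactorial le_rfl (by omega) hnm]
    simp
  refine ⟨fun r hr hrm => ⟨⟨_, cycleFactor_eq_descFactorial hr hrm hnm⟩, ?_,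
    E.TBLen_two_mul_eq hE hr hrm hnm⟩, fun k hk => E.TBLen_of_odd hk, ?_, h4⟩
  · rw [h4, E.TBLen_two_mul_eq hE hr hrm hnm]
  · rw [E.TB_eq_sum_TBLen, h4, Finset.mul_sum]
    refine Finset.sum_congr rfl fun r hr => ?_
    obtain ⟨h2, h3⟩ := Finset.mem_Icc.1 hr
    rw [E.TBLen_two_mul_eq hE h2 h3 hnm, mul_comm]
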